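/- For $N\ge 1$ let $z\in\mathbb R^N$ have i.i.d. standard normal entries, and for $x_0\in\mathbb R^N$ and $\eta>0$ let $y=x_0+\eta z$. Define $$\hat x(\tau)=\operatorname*{argmin}_{x\in\mathbb R^N}\{\|y-x\|_2^2:\|x\|_1\le\tau\},\qquad x^\sharp(\lambda)=\operatorname*{argmin}_{x\in\mathbb R^N}\{\tfrac12\|y-x\|_2^2+\lambda\|x\|_1\}\quad(\mathrm{QP}^*_\lambda),$$ with risks $$\hat R(\tau;x_0,N,\eta)=\eta^{-2}\,\mathbb E\|\hat x(\tau)-x_0\|_2^2,\qquad R^\sharp(\lambda;x_0,N,\eta)=\eta^{-2}\,\mathbb E\|x^\sharp(\eta\lambda)-x_0\|_2^2 .$$ Let $R^*(s,N)=\sup\{\hat R(\|x_0\|_1;x_0,N,\eta): x_0\in\mathbb R^N \text{ has at most } s \text{ non-zero entries}\}$ for a noise level $\eta>0$ (the bound below holds for every $\eta>0$, with constants not depending on $\eta$). Let $R^\sharp(\lambda;s,N)=\lim_{\eta\to0^+}R^\sharp(\lambda;x_0,N,\eta)$, where $x_0\in\mathbb R^N$ has exactly $s$ non-zero entries, and let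 $\lambda^*=\lambda^*(s,N)$ be the minimizer of $\lambda\mapsto R^\sharp(\lambda;s,N)$ over $\lambda>0$. Theorem. $(\mathrm{QP}^*_\lambda)$ is right-sided parameter stable in the following sense. There is an absolute constant $C>0$ such that for all integers $s\ge1$ and all real $L>1$ there is $N_0=N_0(s,L)\ge2$ such that for all $N\ge N_0$: the limit $R^\sharp(\lambda;s,N)$ exists for every $\lambda>0$ and is the same for all $x_0$ with exactly $s$ non-zero entries; the minimizer $\lambda^*$ exists and is unique; $R^*(s,N)>0$; and for $\lambda=L\lambda^*$ $$\frac{R^\sharp(\lambda;s,N)}{R^*(s,N)}\le C L^2 .$$ -/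

import Mathlib

open MeasureTheory ProbabilityTheory Filter Topology

/-- The `ℓ¹` norm on `ℝ^N`. -/
def l1Norm {N : ℕ} (x : Fin N → ℝ) : ℝ := ∑ i, |x i|

/-- The squared Euclidean distance on `ℝ^N`. -/
def sqDist {N : ℕ} (x y : Fin N → ℝ) : ℝ := ∑ i, (x i - y i) ^ 2

/-- The `s`-sparse signals in `ℝ^N`; `hammingNorm x` is the number of non-zero entries of `x`. -/
def sparseSignals (s N : ℕ) : Set (Fin N → ℝ) := {x | hammingNorm x ≤ s}

/-- The law of a noise vector in `ℝ^N` with i.i.d. standard normal entries. -/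
noncomputable def gaussianNoise (N : ℕ) : Measure (Fin N → ℝ) :=
  Measure.pi fun _ => gaussianReal 0 1

/-- `x` is feasible and attains the minimum of `‖y - x‖₂²` over `‖x‖₁ ≤ τ`. -/
def IsLsSolution {N : ℕ} (τ : ℝ) (y x : Fin N → ℝ) : Prop :=
  l1Norm x ≤ τ ∧ ∀ w : Fin N → ℝ, l1Norm w ≤ τ → sqDist y x ≤ sqDist y w

/-- `x` attains the minimum of `½ ‖y - x‖₂² + λ ‖x‖₁`. -/
def IsQpSolution {N : ℕ} (lam : ℝ) (y x : Fin N → ℝ) : Prop :=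
  ∀ w : Fin N → ℝ,
    1 / 2 * sqDist y x + lam * l1Norm x ≤ 1 / 2 * sqDist y w + lam * l1Norm w

theorem l1Norm_midpoint {N : ℕ} (u v : Fin N → ℝ) :
    l1Norm (fun i => (u i + v i) / 2) ≤ (l1Norm u + l1Norm v) / 2 := by
  unfold l1Norm
  rw [← Finset.sum_add_distrib, Finset.sum_div]
  refine Finset.sum_le_sum fun i _ => ?_
  rw [abs_div, abs_two]
  have := abs_add_le (u i) (v i)
  linarith

theorem sqDist_midpoint {N : ℕ} (y u v : Fin N → ℝ) :
    sqDist y (fun i => (u i + v i) / 2)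
      = sqDist y u / 2 + sqDist y v / 2 - sqDist u v / 4 := by
  unfold sqDist
  rw [Finset.sum_div, Finset.sum_div, Finset.sum_div, ← Finset.sum_add_distrib,
    ← Finset.sum_sub_distrib]
  exact Finset.sum_congr rfl fun i _ => by ring

theorem eq_of_sqDist_le_zero {N : ℕ} {u v : Fin N → ℝ} (h : sqDist u v ≤ 0) : u = v := by
  funext i
  have h1 : (u i - v i) ^ 2 ≤ sqDist u v :=
    Finset.single_le_sum (f := fun i => (u i - v i) ^ 2) (fun j _ => sq_nonneg _)
      (Finset.mem_univ i)
  have h2 : (u i - v i) ^ 2 = 0 := le_antisymm (h1.trans h) (sq_nonneg _)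
  have h3 := pow_eq_zero_iff (two_ne_zero) |>.1 h2
  linarith

theorem continuous_sqDist {N : ℕ} (y : Fin N → ℝ) : Continuous fun x => sqDist y x := by
  unfold sqDist; fun_prop

theorem continuous_l1Norm {N : ℕ} : Continuous fun x : Fin N → ℝ => l1Norm x := by
  unfold l1Norm; fun_prop

/-- The constrained program has exactly one solution. -/
theorem existsUnique_isLsSolution {N : ℕ} {τ : ℝ} (hτ : 0 ≤ τ) (y : Fin N → ℝ) :
    ∃! x, IsLsSolution τ y x := by
  have hcl : IsClosed {x : Fin N → ℝ | l1Norm x ≤ τ} :=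
    isClosed_le continuous_l1Norm continuous_const
  have hsub : {x : Fin N → ℝ | l1Norm x ≤ τ} ⊆ Set.Icc (fun _ => -τ) (fun _ => τ) := by
    intro x hx
    have h1 : ∀ i, |x i| ≤ τ := fun i =>
      (Finset.single_le_sum (f := fun i => |x i|) (fun j _ => abs_nonneg _)
        (Finset.mem_univ i)).trans hx
    exact ⟨fun i => (abs_le.1 (h1 i)).1, fun i => (abs_le.1 (h1 i)).2⟩
  have hc : IsCompact {x : Fin N → ℝ | l1Norm x ≤ τ} := isCompact_Icc.of_isClosed_subset hcl hsub
  obtain ⟨x, hx, hmin⟩ := hc.exists_isMinOn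
    ⟨0, by simpa [l1Norm] using hτ⟩ (continuous_sqDist y).continuousOn
  refine ⟨x, ⟨hx, fun w hw => hmin hw⟩, fun u hu => ?_⟩
  apply eq_of_sqDist_le_zero
  have hx' : l1Norm x ≤ τ := hx
  have hm := l1Norm_midpoint u x
  have h1 := hu.2 _ (hm.trans (by linarith [hu.1]))
  have h2 := hu.2 x hx
  have h3 : sqDist y x ≤ sqDist y u := hmin hu.1
  rw [sqDist_midpoint] at h1
  linarith

/-- The unconstrained program has exactly one solution. -/
theorem existsUnique_isQpSolution {N : ℕ} {lam : ℝ} (hlam : 0 ≤ lam) (y : Fin N → ℝ) :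
    ∃! x, IsQpSolution lam y x := by
  set f : (Fin N → ℝ) → ℝ := fun x => 1 / 2 * sqDist y x + lam * l1Norm x with hf
  have hfc : Continuous f :=
    (continuous_const.mul (continuous_sqDist y)).add (continuous_const.mul continuous_l1Norm)
  have hl0 : ∀ x : Fin N → ℝ, 0 ≤ l1Norm x := fun x => Finset.sum_nonneg fun i _ => abs_nonneg _
  set r : ℝ := Real.sqrt (2 * f y) with hr
  have hc : IsCompact {x : Fin N → ℝ | f x ≤ f y} := by
    refine (isCompact_Icc (a := fun i => y i - r) (b := fun i => y i + r)).of_isClosed_subset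
      (isClosed_le hfc continuous_const) fun x hx => ?_
    have h1 : ∀ i, |y i - x i| ≤ r := fun i => by
      apply Real.abs_le_sqrt
      have h2 : (y i - x i) ^ 2 ≤ sqDist y x :=
        Finset.single_le_sum (f := fun i => (y i - x i) ^ 2) (fun j _ => sq_nonneg _)
          (Finset.mem_univ i)
      have h3 : 1 / 2 * sqDist y x + lam * l1Norm x ≤ f y := hx
      have h4 := mul_nonneg hlam (hl0 x)
      linarith
    refine ⟨fun i => ?_, fun i => ?_⟩
    · have := (abs_le.1 (h1 i)).2
      show y i - r ≤ x i
      linarith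
    · have := (abs_le.1 (h1 i)).1
      show x i ≤ y i + r
      linarith
  obtain ⟨x, hx, hmin⟩ := hc.exists_isMinOn ⟨y, le_refl (f y)⟩ hfc.continuousOn
  have hxall : ∀ w, f x ≤ f w := fun w => by
    by_cases hw : f w ≤ f y
    · exact hmin hw
    · have hx' : f x ≤ f y := hx
      linarith
  refine ⟨x, hxall, fun u hu => ?_⟩
  apply eq_of_sqDist_le_zero
  have h1 := hu (fun i => (u i + x i) / 2)
  have h2 : 1 / 2 * sqDist y x + lam * l1Norm x ≤ 1 / 2 * sqDist y u + lam * l1Norm u := hxall u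
  have h3 := mul_le_mul_of_nonneg_left (l1Norm_midpoint u x) hlam
  rw [sqDist_midpoint] at h1
  linarith

/-- The constrained proximal denoiser: the argmin of `‖y - x‖₂²` over `‖x‖₁ ≤ τ`. -/
noncomputable def lsEstimator {N : ℕ} (τ : ℝ) (y : Fin N → ℝ) : Fin N → ℝ :=
  Classical.epsilon (IsLsSolution τ y)

/-- The unconstrained proximal denoiser: the argmin of `½ ‖y - x‖₂² + λ ‖x‖₁`. -/
noncomputable def qpEstimator {N : ℕ} (lam : ℝ) (y : Fin N → ℝ) : Fin N → ℝ :=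
  Classical.epsilon (IsQpSolution lam y)

/-- The noise-normalized risk of the constrained denoiser for `y = x₀ + η z`. -/
noncomputable def lsRisk {N : ℕ} (τ : ℝ) (x₀ : Fin N → ℝ) (η : ℝ) : ℝ :=
  (η ^ 2)⁻¹ * ∫ z, sqDist (lsEstimator τ (x₀ + η • z)) x₀ ∂(gaussianNoise N)

/-- The noise-normalized risk of the unconstrained denoiser, run with parameter `η λ`,
for `y = x₀ + η z`. -/
noncomputable def qpRisk {N : ℕ} (lam : ℝ) (x₀ : Fin N → ℝ) (η : ℝ) : ℝ :=
  (η ^ 2)⁻¹ * ∫ z, sqDist (qpEstimator (η * lam) (x₀ + η • z)) x₀ ∂(gaussianNoise N)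

/-- The optimally tuned worst-case risk `R*(s, N)` of the constrained denoiser,
at noise level `η`. -/
noncomputable def lsOptRisk (s N : ℕ) (η : ℝ) : ℝ :=
  ⨆ x₀ : sparseSignals s N, lsRisk (l1Norm x₀.1) x₀.1 η

/-- The signal in `ℝ^N` whose first `s` entries are `1` and whose other entries are `0`. -/
def flatSignal (s N : ℕ) : Fin N → ℝ := fun i => if (i : ℕ) < s then 1 else 0

/-- The low-noise risk `R♯(λ; s, N)`: the limit as `η → 0⁺` of the risk at a signal with exactly
`s` non-zero entries (the limit is the same for all of them). -/
noncomputable def lowNoiseRisk (lam : ℝ) (s N : ℕ) : ℝ :=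
  limUnder (𝓝[>] (0 : ℝ)) (qpRisk lam (flatSignal s N))

/-- `lamStar` minimizes the low-noise risk over the positive parameters. -/
def IsOptimalParam (s N : ℕ) (lamStar : ℝ) : Prop :=
  0 < lamStar ∧ ∀ lam : ℝ, 0 < lam → lowNoiseRisk lamStar s N ≤ lowNoiseRisk lam s N

/-! The unconstrained program separates into soft thresholding of each coordinate. As `η → 0⁺`, a
nonzero entry contributes `1 + λ²` to the risk, and a zero entry contributes `G(λ) = E (|z| - λ)₊²`
for every `η > 0`. Hence the low-noise risk is `F(λ) = s(1 + λ²) + (N - s) G(λ)`. Strict convexity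
of `F` and `F(0) = N` give a unique positive minimizer once `F` drops below `N` somewhere. Since `G`
is nonincreasing, `F(Lλ) ≤ L² F(λ)`, and the Gaussian tail of `G` at `λ = √(2 log N)` gives `F(λ*) ≤
7 s log N` (`limitRisk_mul_le`, `limitRisk_sqrt_log_le`).

It remains to bound the constrained risk below by a multiple of `s log N` (`lsOptRisk_ge_log`). Take
a flat signal whose height is large compared with the noise. Each support index owns a disjoint
block of roughly `N/s` indices off the support. With probability at least `1/4`, its own noise is
nonpositive while its block contains an entry of order `√(log N)`. Moving `ℓ¹` mass from the support
index to that entry keeps the norm fixed and follows the noise, so the projection must incur an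
error of order `η² log N` per such pair (`le_sqDist_lsEstimator_of_pairing`). Averaging over the
support indices gives the bound. -/

/-! ### Soft thresholding and the unconstrained program -/

/-- Soft thresholding of a real number. -/
noncomputable def softThreshold (lam x : ℝ) : ℝ := max (x - lam) 0 - max (-x - lam) 0

theorem continuous_softThreshold (lam : ℝ) : Continuous (softThreshold lam) := by
  unfold softThreshold; fun_prop

theorem softThreshold_of_le {lam x : ℝ} (h0 : 0 ≤ lam) (h : lam ≤ x) :
    softThreshold lam x = x - lam := by
  unfold softThreshold
  rw [max_eq_left (by linarith), max_eq_right (by linarith), sub_zero]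

theorem softThreshold_of_le_neg {lam x : ℝ} (h0 : 0 ≤ lam) (h : x ≤ -lam) :
    softThreshold lam x = x + lam := by
  unfold softThreshold
  rw [max_eq_right (by linarith), max_eq_left (by linarith)]
  ring

theorem softThreshold_of_abs_le {lam x : ℝ} (h : |x| ≤ lam) : softThreshold lam x = 0 := by
  have := abs_le.1 h
  unfold softThreshold
  rw [max_eq_right (by linarith), max_eq_right (by linarith), sub_zero]

theorem softThreshold_cases {lam : ℝ} (h0 : 0 ≤ lam) (x : ℝ) :
    (lam ≤ x ∧ softThreshold lam x = x - lam) ∨ (x ≤ -lam ∧ softThreshold lam x = x + lam) ∨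
      (|x| ≤ lam ∧ softThreshold lam x = 0) := by
  rcases le_or_gt lam x with h | h
  · exact Or.inl ⟨h, softThreshold_of_le h0 h⟩
  rcases le_or_gt x (-lam) with h' | h'
  · exact Or.inr (Or.inl ⟨h', softThreshold_of_le_neg h0 h'⟩)
  have : |x| ≤ lam := abs_le.2 ⟨h'.le, h.le⟩
  exact Or.inr (Or.inr ⟨this, softThreshold_of_abs_le this⟩)

theorem abs_softThreshold_sub_le {lam : ℝ} (h0 : 0 ≤ lam) (x : ℝ) :
    |softThreshold lam x - x| ≤ lam := by
  rcases softThreshold_cases h0 x with ⟨_, e⟩ | ⟨_, e⟩ | ⟨h, e⟩ <;> rw [e]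
  · rw [abs_le]; constructor <;> linarith
  · rw [abs_le]; constructor <;> linarith
  · simpa using h

theorem softThreshold_mul {η : ℝ} (hη : 0 ≤ η) (lam x : ℝ) :
    softThreshold (η * lam) (η * x) = η * softThreshold lam x := by
  unfold softThreshold
  rw [mul_sub, mul_max_of_nonneg _ _ hη, mul_max_of_nonneg _ _ hη]
  ring_nf

theorem softThreshold_sq {lam : ℝ} (h0 : 0 ≤ lam) (x : ℝ) :
    softThreshold lam x ^ 2 = max (|x| - lam) 0 ^ 2 := by
  rcases softThreshold_cases h0 x with ⟨h, e⟩ | ⟨h, e⟩ | ⟨h, e⟩ <;> rw [e]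
  · rw [abs_of_nonneg (h0.trans h), max_eq_left (by linarith)]
  · rw [abs_of_nonpos (by linarith), max_eq_left (by linarith)]; ring
  · rw [max_eq_right (by linarith)]

theorem softThreshold_minimizes {lam : ℝ} (h0 : 0 ≤ lam) (y w : ℝ) :
    1 / 2 * (y - softThreshold lam y) ^ 2 + lam * |softThreshold lam y|
      ≤ 1 / 2 * (y - w) ^ 2 + lam * |w| := by
  rcases softThreshold_cases h0 y with ⟨h, e⟩ | ⟨h, e⟩ | ⟨h, e⟩ <;> rw [e]
  · rw [abs_of_nonneg (by linarith : 0 ≤ y - lam)]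
    nlinarith [sq_nonneg (y - w - lam), mul_le_mul_of_nonneg_left (le_abs_self w) h0]
  · rw [abs_of_nonpos (by linarith : y + lam ≤ 0)]
    nlinarith [sq_nonneg (y - w + lam), mul_le_mul_of_nonneg_left (neg_le_abs w) h0]
  · have h1 : y * w ≤ lam * |w| := by
      calc y * w ≤ |y * w| := le_abs_self _
        _ = |y| * |w| := abs_mul _ _
        _ ≤ lam * |w| := mul_le_mul_of_nonneg_right h (abs_nonneg _)
    rw [abs_zero]
    nlinarith [sq_nonneg w]

theorem qpEstimator_eq_softThreshold {N : ℕ} {lam : ℝ} (h0 : 0 ≤ lam) (y : Fin N → ℝ) :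
    qpEstimator lam y = fun i => softThreshold lam (y i) := by
  refine (existsUnique_isQpSolution h0 y).unique
    (Classical.epsilon_spec (existsUnique_isQpSolution h0 y).exists) fun w => ?_
  unfold sqDist l1Norm
  simp only [Finset.mul_sum, ← Finset.sum_add_distrib]
  exact Finset.sum_le_sum fun i _ => softThreshold_minimizes h0 (y i) (w i)

/-! ### Coordinate risks and their low-noise limit -/

/-- The mean squared error of soft thresholding of pure noise. -/
noncomputable def noiseShrinkRisk (lam : ℝ) : ℝ :=
  ∫ z, max (|z| - lam) 0 ^ 2 ∂(gaussianReal 0 1)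

/-- The noise-normalized risk of soft thresholding of one coordinate. -/
noncomputable def coordRisk (lam x η : ℝ) : ℝ :=
  ∫ z, ((softThreshold (η * lam) (x + η * z) - x) / η) ^ 2 ∂(gaussianReal 0 1)

theorem integrable_sq_gaussian : Integrable (fun z : ℝ => z ^ 2) (gaussianReal 0 1) :=
  (memLp_id_gaussianReal 2).integrable_sq

theorem integrable_id_gaussian : Integrable (fun z : ℝ => z) (gaussianReal 0 1) :=
  (memLp_id_gaussianReal 1).integrable le_rfl

theorem integral_sq_gaussian : ∫ z : ℝ, z ^ 2 ∂(gaussianReal 0 1) = 1 := by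
  have h := variance_eq_sub (μ := gaussianReal 0 1) (X := id) (memLp_id_gaussianReal 2)
  rw [variance_id_gaussianReal] at h
  simpa using h.symm

theorem integrable_abs_add_sq (c : ℝ) :
    Integrable (fun z : ℝ => (|z| + c) ^ 2) (gaussianReal 0 1) := by
  have h : (fun z : ℝ => (|z| + c) ^ 2) = fun z => z ^ 2 + (2 * c) * |z| + c ^ 2 := by
    funext z; rw [← sq_abs z]; ring
  rw [h]
  exact (integrable_sq_gaussian.add (integrable_id_gaussian.abs.const_mul _)).add
    (integrable_const _)

/-- Thresholding moves its input by at most `η * lam`. The bound is free of `η`, so it serves as the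
dominating function in the limit `η → 0⁺`. -/
theorem coord_error_sq_le {lam η : ℝ} (h0 : 0 ≤ lam) (hη : 0 < η) (x z : ℝ) :
    ((softThreshold (η * lam) (x + η * z) - x) / η) ^ 2 ≤ (|z| + lam) ^ 2 := by
  apply sq_le_sq'
  all_goals
    have h := abs_le.1 (abs_softThreshold_sub_le (mul_nonneg hη.le h0) (x + η * z))
    have h1 := mul_le_mul_of_nonneg_left (neg_abs_le z) hη.le
    have h2 := mul_le_mul_of_nonneg_left (le_abs_self z) hη.le
  · rw [le_div_iff₀ hη]; nlinarith
  · rw [div_le_iff₀ hη]; nlinarith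

theorem integrable_coord_error {lam η : ℝ} (h0 : 0 ≤ lam) (hη : 0 < η) (x : ℝ) :
    Integrable (fun z => ((softThreshold (η * lam) (x + η * z) - x) / η) ^ 2)
      (gaussianReal 0 1) := by
  refine (integrable_abs_add_sq lam).mono' ?_ (ae_of_all _ fun z => ?_)
  · have := continuous_softThreshold (η * lam)
    exact Continuous.aestronglyMeasurable (by fun_prop)
  · rw [Real.norm_of_nonneg (sq_nonneg _)]
    exact coord_error_sq_le h0 hη x z

theorem measurePreserving_eval_gaussianNoise {N : ℕ} (i : Fin N) :
    MeasurePreserving (fun z : Fin N → ℝ => z i) (gaussianNoise N) (gaussianReal 0 1) :=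
  measurePreserving_eval (fun _ : Fin N => gaussianReal 0 1) i

theorem qpRisk_eq_sum {N : ℕ} {lam η : ℝ} (h0 : 0 ≤ lam) (hη : 0 < η) (x₀ : Fin N → ℝ) :
    qpRisk lam x₀ η = ∑ i, coordRisk lam (x₀ i) η := by
  have hint : ∀ i : Fin N, Integrable
      (fun z : Fin N → ℝ => ((softThreshold (η * lam) (x₀ i + η * z i) - x₀ i) / η) ^ 2)
      (gaussianNoise N) := fun i =>
    (measurePreserving_eval_gaussianNoise i).integrable_comp_of_integrable
      (integrable_coord_error h0 hη (x₀ i))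
  have hc : ∀ i : Fin N, coordRisk lam (x₀ i) η =
      ∫ z, ((softThreshold (η * lam) (x₀ i + η * z i) - x₀ i) / η) ^ 2 ∂(gaussianNoise N) := by
    intro i
    have hm := measurePreserving_eval_gaussianNoise i
    unfold coordRisk
    rw [← hm.map_eq, integral_map hm.measurable.aemeasurable]
    rw [hm.map_eq]
    exact (integrable_coord_error h0 hη (x₀ i)).aestronglyMeasurable
  simp_rw [hc]
  rw [← integral_finsetSum _ fun i _ => hint i]
  unfold qpRisk
  rw [← integral_const_mul]
  refine integral_congr_ae (ae_of_all _ fun z => ?_)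
  simp only [qpEstimator_eq_softThreshold (mul_nonneg hη.le h0), sqDist, Finset.mul_sum]
  refine Finset.sum_congr rfl fun i _ => ?_
  simp only [Pi.add_apply, Pi.smul_apply, smul_eq_mul]
  rw [div_pow]
  ring

theorem coordRisk_zero {lam η : ℝ} (h0 : 0 ≤ lam) (hη : 0 < η) :
    coordRisk lam 0 η = noiseShrinkRisk lam := by
  unfold coordRisk noiseShrinkRisk
  refine integral_congr_ae (ae_of_all _ fun z => ?_)
  simp only [zero_add, sub_zero]
  rw [softThreshold_mul hη.le, mul_div_cancel_left₀ _ hη.ne', softThreshold_sq h0]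

theorem integral_sub_sq_gaussian (c : ℝ) :
    ∫ z : ℝ, (z - c) ^ 2 ∂(gaussianReal 0 1) = 1 + c ^ 2 := by
  have h : (fun z : ℝ => (z - c) ^ 2) = fun z => (z ^ 2 - (2 * c) * z) + c ^ 2 := by
    funext z; ring
  have hi : ∫ z : ℝ, z ∂(gaussianReal 0 1) = 0 := integral_id_gaussianReal
  have h1 : Integrable (fun z : ℝ => z ^ 2 - (2 * c) * z) (gaussianReal 0 1) :=
    integrable_sq_gaussian.sub (integrable_id_gaussian.const_mul _)
  rw [h, integral_add h1 (integrable_const _), integral_sub integrable_sq_gaussian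
    (integrable_id_gaussian.const_mul _), integral_const_mul, integral_sq_gaussian, hi]
  simp

/-- For fixed `z` and small `η`, the input lies beyond the threshold on the side of `x`, so the
error equals its limit exactly: the convergence is eventual equality. -/
theorem tendsto_coord_error {lam x : ℝ} (h0 : 0 ≤ lam) (hx : x ≠ 0) (z : ℝ) :
    Tendsto (fun η : ℝ => ((softThreshold (η * lam) (x + η * z) - x) / η) ^ 2)
      (𝓝[>] (0 : ℝ)) (𝓝 ((z - lam * SignType.sign x) ^ 2)) := by
  refine tendsto_const_nhds.congr' ?_
  have hc1 : ∀ c : ℝ, Tendsto (fun η : ℝ => η * c) (𝓝[>] (0 : ℝ)) (𝓝 0) := fun c => by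
    have : Tendsto (fun η : ℝ => η * c) (𝓝 0) (𝓝 (0 * c)) :=
      (continuous_id.mul continuous_const).tendsto 0
    rw [zero_mul] at this
    exact this.mono_left nhdsWithin_le_nhds
  rcases lt_or_gt_of_ne hx with h | h
  · filter_upwards [self_mem_nhdsWithin, (hc1 (z + lam)).eventually (gt_mem_nhds (neg_pos.2 h))]
      with η hη h1
    have hη : 0 < η := hη
    rw [softThreshold_of_le_neg (by positivity) (by nlinarith), sign_neg h]
    simp only [SignType.coe_neg_one]
    field_simp
    ring
  · filter_upwards [self_mem_nhdsWithin, (hc1 (lam - z)).eventually (gt_mem_nhds h)]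
      with η hη h1
    have hη : 0 < η := hη
    rw [softThreshold_of_le (by positivity) (by nlinarith), sign_pos h]
    simp only [SignType.coe_one]
    field_simp
    ring

theorem tendsto_coordRisk {lam x : ℝ} (h0 : 0 ≤ lam) (hx : x ≠ 0) :
    Tendsto (coordRisk lam x) (𝓝[>] (0 : ℝ)) (𝓝 (1 + lam ^ 2)) := by
  have h : 1 + lam ^ 2 = ∫ z : ℝ, (z - lam * SignType.sign x) ^ 2 ∂(gaussianReal 0 1) := by
    rw [integral_sub_sq_gaussian]
    rcases lt_or_gt_of_ne hx with h | h
    · rw [sign_neg h]; simp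
    · rw [sign_pos h]; simp
  rw [h]
  refine tendsto_integral_filter_of_dominated_convergence (fun z => (|z| + lam) ^ 2) ?_ ?_
    (integrable_abs_add_sq lam) (ae_of_all _ fun z => tendsto_coord_error h0 hx z)
  · filter_upwards [self_mem_nhdsWithin] with η hη
    exact (integrable_coord_error h0 hη x).aestronglyMeasurable
  · filter_upwards [self_mem_nhdsWithin] with η hη
    refine ae_of_all _ fun z => ?_
    rw [Real.norm_of_nonneg (sq_nonneg _)]
    exact coord_error_sq_le h0 hη x z

/-- The closed form of the low-noise risk at sparsity `s` in dimension `N`. -/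
noncomputable def limitRisk (s N : ℕ) (lam : ℝ) : ℝ :=
  s * (1 + lam ^ 2) + ((N : ℝ) - s) * noiseShrinkRisk lam

theorem tendsto_qpRisk {s N : ℕ} {lam : ℝ} (h0 : 0 ≤ lam) {x₀ : Fin N → ℝ}
    (hx : hammingNorm x₀ = s) :
    Tendsto (qpRisk lam x₀) (𝓝[>] (0 : ℝ)) (𝓝 (limitRisk s N lam)) := by
  have h1 : Tendsto (fun η => ∑ i, coordRisk lam (x₀ i) η) (𝓝[>] (0 : ℝ))
      (𝓝 (∑ i, if x₀ i ≠ 0 then 1 + lam ^ 2 else noiseShrinkRisk lam)) := by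
    refine tendsto_finsetSum _ fun i _ => ?_
    by_cases hi : x₀ i = 0
    · rw [if_neg (by simpa using hi), hi]
      refine tendsto_const_nhds.congr' ?_
      filter_upwards [self_mem_nhdsWithin] with η hη
      exact (coordRisk_zero h0 hη).symm
    · rw [if_pos hi]
      exact tendsto_coordRisk h0 hi
  have h2 : (∑ i, if x₀ i ≠ 0 then 1 + lam ^ 2 else noiseShrinkRisk lam)
      = limitRisk s N lam := by
    have hcard : (Finset.univ.filter fun i => x₀ i ≠ 0).card = s := hx
    have hadd := Finset.card_filter_add_card_filter_not (s := (Finset.univ : Finset (Fin N)))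
      (fun i => x₀ i ≠ 0)
    rw [hcard, Finset.card_univ, Fintype.card_fin] at hadd
    have hN : (s : ℝ) + ((Finset.univ.filter fun i => ¬ x₀ i ≠ 0).card : ℝ) = N := by
      exact_mod_cast hadd
    rw [Finset.sum_ite, Finset.sum_const, Finset.sum_const, nsmul_eq_mul, nsmul_eq_mul, hcard]
    unfold limitRisk
    rw [← hN]
    ring
  rw [← h2]
  refine h1.congr' ?_
  filter_upwards [self_mem_nhdsWithin] with η hη
  exact (qpRisk_eq_sum h0 hη x₀).symm

theorem card_filter_val_lt {s N : ℕ} (h : s ≤ N) :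
    (Finset.univ.filter fun i : Fin N => (i : ℕ) < s).card = s := by
  rw [← Finset.card_map Fin.valEmbedding]
  rw [show (Finset.univ.filter fun i : Fin N => (i : ℕ) < s).map Fin.valEmbedding
    = Finset.range s from ?_, Finset.card_range]
  ext k
  simp only [Finset.mem_map, Finset.mem_filter, Finset.mem_univ, true_and, Fin.valEmbedding_apply,
    Finset.mem_range]
  exact ⟨fun ⟨i, hi, e⟩ => e ▸ hi, fun hk => ⟨⟨k, hk.trans_le h⟩, hk, rfl⟩⟩

theorem hammingNorm_flatSignal {s N : ℕ} (h : s ≤ N) : hammingNorm (flatSignal s N) = s := by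
  refine Eq.trans ?_ (card_filter_val_lt h)
  unfold hammingNorm flatSignal
  congr 1
  ext i
  simp

/-- The hypothesis `s ≤ N` ensures that the flat signal really has `s` nonzero entries. -/
theorem lowNoiseRisk_eq {s N : ℕ} (h : s ≤ N) {lam : ℝ} (h0 : 0 ≤ lam) :
    lowNoiseRisk lam s N = limitRisk s N lam :=
  (tendsto_qpRisk h0 (hammingNorm_flatSignal h)).limUnder_eq

/-! ### Monotonicity, convexity and Gaussian decay of the pure-noise risk -/

theorem integrable_shrink_sq (lam : ℝ) :
    Integrable (fun z : ℝ => max (|z| - lam) 0 ^ 2) (gaussianReal 0 1) := by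
  refine (integrable_abs_add_sq |lam|).mono' (Continuous.aestronglyMeasurable (by fun_prop))
    (ae_of_all _ fun z => ?_)
  rw [Real.norm_of_nonneg (sq_nonneg _)]
  refine pow_le_pow_left₀ (le_max_right _ _) (max_le ?_ (by positivity)) 2
  linarith [neg_abs_le lam]

theorem noiseShrinkRisk_nonneg (lam : ℝ) : 0 ≤ noiseShrinkRisk lam :=
  integral_nonneg fun _ => sq_nonneg _

theorem noiseShrinkRisk_antitone : Antitone noiseShrinkRisk := fun a b h =>
  integral_mono (integrable_shrink_sq b) (integrable_shrink_sq a) fun z =>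
    pow_le_pow_left₀ (le_max_right _ _) (max_le_max_right 0 (by linarith)) 2

theorem noiseShrinkRisk_zero : noiseShrinkRisk 0 = 1 := by
  rw [← integral_sq_gaussian]
  refine integral_congr_ae (ae_of_all _ fun z => ?_)
  simp

theorem convexOn_noiseShrinkRisk : ConvexOn ℝ Set.univ noiseShrinkRisk := by
  refine ⟨convex_univ, fun a _ b _ p q hp hq hpq => ?_⟩
  simp only [smul_eq_mul]
  unfold noiseShrinkRisk
  rw [← integral_const_mul, ← integral_const_mul,
    ← integral_add ((integrable_shrink_sq a).const_mul p) ((integrable_shrink_sq b).const_mul q)]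
  refine integral_mono (integrable_shrink_sq _)
    (((integrable_shrink_sq a).const_mul p).add ((integrable_shrink_sq b).const_mul q))
    fun z => ?_
  have h1 : max (|z| - (p * a + q * b)) 0 ≤ p * max (|z| - a) 0 + q * max (|z| - b) 0 := by
    refine max_le ?_ (by positivity)
    have ha := mul_le_mul_of_nonneg_left (le_max_left (|z| - a) 0) hp
    have hb := mul_le_mul_of_nonneg_left (le_max_left (|z| - b) 0) hq
    have hz : |z| = p * |z| + q * |z| := by rw [← add_mul, hpq, one_mul]
    linarith
  refine (pow_le_pow_left₀ (le_max_right _ _) h1 2).trans ?_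
  exact ((convexOn_pow 2).2 (le_max_right (|z| - a) 0) (le_max_right (|z| - b) 0) hp hq hpq)

theorem sq_le_exp_mul {c x : ℝ} (hc : 0 < c) (hx : 0 ≤ x) :
    x ^ 2 ≤ 2 / c ^ 2 * Real.exp (c * x) := by
  have h := Real.quadratic_le_exp_of_nonneg (mul_nonneg hc.le hx)
  rw [div_mul_eq_mul_div, le_div_iff₀ (by positivity)]
  nlinarith [mul_nonneg hc.le hx]

theorem integrable_exp_mul_gaussian (t : ℝ) :
    Integrable (fun z : ℝ => Real.exp (t * z)) (gaussianReal 0 1) :=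
  integrable_exp_mul_gaussianReal t

theorem integral_exp_mul_gaussian (t : ℝ) :
    ∫ z : ℝ, Real.exp (t * z) ∂(gaussianReal 0 1) = Real.exp (t ^ 2 / 2) := by
  have h := congrFun (mgf_id_gaussianReal (μ := 0) (v := 1)) t
  simpa [mgf] using h

/-- A Chernoff bound with exponent `lam`: a square is dominated by an exponential, and the factor
`exp (-lam ^ 2)` meets the moment generating function `exp (lam ^ 2 / 2)` twice, once for each sign
of `z`. -/
theorem noiseShrinkRisk_le {lam : ℝ} (h : 1 ≤ lam) :
    noiseShrinkRisk lam ≤ 4 * Real.exp (-(lam ^ 2 / 2)) := by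
  have h0 : 0 < lam := by linarith
  have hpt : ∀ z : ℝ, max (|z| - lam) 0 ^ 2 ≤
      2 * Real.exp (-lam ^ 2) * (Real.exp (lam * z) + Real.exp (-lam * z)) := by
    intro z
    rcases le_total (|z| - lam) 0 with hz | hz
    · rw [max_eq_right hz, zero_pow two_ne_zero]; positivity
    rw [max_eq_left hz]
    have h2 : 2 / lam ^ 2 ≤ 2 := div_le_self (by norm_num) (by nlinarith)
    have h3 : Real.exp (lam * (|z| - lam)) = Real.exp (-lam ^ 2) * Real.exp (lam * |z|) := by
      rw [← Real.exp_add]; ring_nf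
    have h4 : Real.exp (lam * |z|) ≤ Real.exp (lam * z) + Real.exp (-lam * z) := by
      rcases abs_choice z with e | e <;> rw [e]
      · linarith [Real.exp_pos (-lam * z)]
      · rw [mul_neg, ← neg_mul]; linarith [Real.exp_pos (lam * z)]
    calc (|z| - lam) ^ 2 ≤ 2 / lam ^ 2 * Real.exp (lam * (|z| - lam)) := sq_le_exp_mul h0 hz
      _ ≤ 2 * Real.exp (lam * (|z| - lam)) := by gcongr
      _ = 2 * Real.exp (-lam ^ 2) * Real.exp (lam * |z|) := by rw [h3]; ring
      _ ≤ _ := by gcongr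
  have hi := (integrable_exp_mul_gaussian lam).add (integrable_exp_mul_gaussian (-lam))
  calc noiseShrinkRisk lam
      ≤ ∫ z, 2 * Real.exp (-lam ^ 2) * (Real.exp (lam * z) + Real.exp (-lam * z))
          ∂(gaussianReal 0 1) :=
        integral_mono (integrable_shrink_sq lam) (hi.const_mul _) hpt
    _ = 2 * Real.exp (-lam ^ 2) * (Real.exp (lam ^ 2 / 2) + Real.exp (lam ^ 2 / 2)) := by
        rw [integral_const_mul, integral_add (integrable_exp_mul_gaussian lam)
          (integrable_exp_mul_gaussian (-lam)), integral_exp_mul_gaussian,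
          integral_exp_mul_gaussian, neg_sq]
    _ = 4 * (Real.exp (-lam ^ 2) * Real.exp (lam ^ 2 / 2)) := by ring
    _ = _ := by rw [← Real.exp_add]; ring_nf

/-! ### The optimal parameter and scaling of the low-noise risk -/

theorem strictConvexOn_limitRisk {s N : ℕ} (hs : 1 ≤ s) (hN : s ≤ N) :
    StrictConvexOn ℝ Set.univ (limitRisk s N) := by
  have hs' : (0 : ℝ) < s := by exact_mod_cast hs
  have hN' : (0 : ℝ) ≤ (N : ℝ) - s := sub_nonneg.2 (by exact_mod_cast hN)
  have h1 : StrictConvexOn ℝ Set.univ fun x : ℝ => (s : ℝ) * (1 + x ^ 2) := by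
    refine ⟨convex_univ, fun a _ b _ hab p q hp hq hpq => ?_⟩
    simp only [smul_eq_mul]
    have hq' : q = 1 - p := by linarith
    have h2 : 0 < p * q * (a - b) ^ 2 := by
      have := sq_pos_of_ne_zero (sub_ne_zero.2 hab)
      positivity
    subst hq'
    nlinarith [mul_pos hs' h2]
  exact h1.add_convexOn (convexOn_noiseShrinkRisk.smul hN')

theorem continuous_limitRisk {s N : ℕ} (hs : 1 ≤ s) (hN : s ≤ N) :
    Continuous (limitRisk s N) :=
  continuousOn_univ.1 ((strictConvexOn_limitRisk hs hN).convexOn.continuousOn isOpen_univ)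

theorem limitRisk_zero (s N : ℕ) : limitRisk s N 0 = N := by
  unfold limitRisk; rw [noiseShrinkRisk_zero]; ring

/-- At this threshold each zero entry costs at most `4 / N`, so all of them together cost at most
`4`. The rest is `s * (1 + 2 * log N)`, and `log N ≥ 1` absorbs the constants. -/
theorem limitRisk_sqrt_log_le {s N : ℕ} (hs : 1 ≤ s) (hN : s ≤ N) (h3 : 3 ≤ N) :
    limitRisk s N (Real.sqrt (2 * Real.log N)) ≤ 7 * s * Real.log N := by
  have hs' : (1 : ℝ) ≤ s := by exact_mod_cast hs
  have hN' : (s : ℝ) ≤ N := by exact_mod_cast hN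
  have h3' : (3 : ℝ) ≤ N := by exact_mod_cast h3
  have hlog : 1 ≤ Real.log N := by
    rw [Real.le_log_iff_exp_le (by linarith)]
    linarith [Real.exp_one_lt_d9]
  have hsq : Real.sqrt (2 * Real.log N) ^ 2 = 2 * Real.log N := Real.sq_sqrt (by linarith)
  have hG := noiseShrinkRisk_le (lam := Real.sqrt (2 * Real.log N))
    (Real.one_le_sqrt.2 (by linarith))
  rw [hsq, mul_div_cancel_left₀ _ two_ne_zero, Real.exp_neg,
    Real.exp_log (by linarith)] at hG
  have h4 : ((N : ℝ) - s) * noiseShrinkRisk (Real.sqrt (2 * Real.log N)) ≤ 4 := by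
    calc ((N : ℝ) - s) * noiseShrinkRisk (Real.sqrt (2 * Real.log N))
        ≤ N * (4 * (N : ℝ)⁻¹) :=
          mul_le_mul (by linarith) hG (noiseShrinkRisk_nonneg _) (by linarith)
      _ = 4 := by field_simp
  unfold limitRisk
  rw [hsq]
  nlinarith [mul_le_mul hs' hlog zero_le_one (by linarith)]

/-- Raising the threshold does not increase the noise term, and the signal term grows by at most the
factor `L ^ 2`. -/
theorem limitRisk_mul_le {s N : ℕ} (hN : s ≤ N) {L lam : ℝ} (hL : 1 ≤ L) (h0 : 0 ≤ lam) :
    limitRisk s N (L * lam) ≤ L ^ 2 * limitRisk s N lam := by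
  have hN' : (0 : ℝ) ≤ (N : ℝ) - s := sub_nonneg.2 (by exact_mod_cast hN)
  have hL2 : 1 ≤ L ^ 2 := one_le_pow₀ hL
  have h1 : noiseShrinkRisk (L * lam) ≤ L ^ 2 * noiseShrinkRisk lam :=
    (noiseShrinkRisk_antitone (le_mul_of_one_le_left h0 hL)).trans
      (le_mul_of_one_le_left (noiseShrinkRisk_nonneg _) hL2)
  have h2 : (s : ℝ) * (1 + (L * lam) ^ 2) ≤ s * (L ^ 2 * (1 + lam ^ 2)) := by
    gcongr
    nlinarith
  unfold limitRisk
  nlinarith [mul_le_mul_of_nonneg_left h1 hN']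

theorem existsUnique_isOptimalParam {s N : ℕ} (hs : 1 ≤ s) (hN : s ≤ N) {lam₀ : ℝ}
    (h0 : 0 ≤ lam₀) (hlt : limitRisk s N lam₀ < N) :
    ∃! lamStar : ℝ, IsOptimalParam s N lamStar := by
  have hs' : (1 : ℝ) ≤ s := by exact_mod_cast hs
  have hN' : (0 : ℝ) ≤ (N : ℝ) - s := sub_nonneg.2 (by exact_mod_cast hN)
  obtain ⟨x, hx, hmin⟩ := (isCompact_Icc (a := (0 : ℝ)) (b := N)).exists_isMinOn
    ⟨0, by simp⟩ (continuous_limitRisk hs hN).continuousOn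
  -- Beyond `N` the signal term suffices: `s * (1 + w ^ 2) ≥ 1 + w ^ 2 > w > N`. Minimizing over
  -- `[0, N]` is therefore enough.
  have hbig : ∀ w : ℝ, (N : ℝ) < w → (N : ℝ) < limitRisk s N w := fun w hw => by
    have h1 : 0 ≤ ((N : ℝ) - s) * noiseShrinkRisk w := mul_nonneg hN' (noiseShrinkRisk_nonneg _)
    unfold limitRisk
    nlinarith [sq_nonneg (w - 1), sq_nonneg w]
  have hx0 : limitRisk s N x ≤ N := by
    rw [← limitRisk_zero s N]; exact hmin (by simp)
  have hall : ∀ w : ℝ, 0 ≤ w → limitRisk s N x ≤ limitRisk s N w := fun w hw => by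
    rcases le_or_gt w N with h | h
    · exact hmin ⟨hw, h⟩
    · linarith [hbig w h]
  -- The value at `0` is `N`, which `lam₀` beats.
  have hxpos : 0 < x := by
    refine lt_of_le_of_ne hx.1 fun e => ?_
    have h1 := hall lam₀ h0
    rw [← e, limitRisk_zero] at h1
    linarith
  refine ⟨x, ⟨hxpos, fun w hw => ?_⟩, fun u hu => ?_⟩
  · rw [lowNoiseRisk_eq hN hxpos.le, lowNoiseRisk_eq hN hw.le]
    exact hall w hw.le
  · have hst := (strictConvexOn_limitRisk hs hN).subset (Set.subset_univ (Set.Ioi 0))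
      (convex_Ioi 0)
    refine hst.eq_of_isMinOn (fun w hw => ?_) (fun w hw => hall w (le_of_lt hw)) hu.1 hxpos
    have := hu.2 w hw
    rwa [lowNoiseRisk_eq hN hu.1.le, lowNoiseRisk_eq hN (le_of_lt hw)] at this

/-! ### Projection onto the `ℓ¹` ball -/

theorem l1Norm_nonneg {N : ℕ} (x : Fin N → ℝ) : 0 ≤ l1Norm x :=
  Finset.sum_nonneg fun _ _ => abs_nonneg _

theorem lsEstimator_spec {N : ℕ} {τ : ℝ} (hτ : 0 ≤ τ) (y : Fin N → ℝ) :
    IsLsSolution τ y (lsEstimator τ y) :=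
  Classical.epsilon_spec (existsUnique_isLsSolution hτ y).exists

/-- The variational inequality of the projection onto the `ℓ¹` ball. -/
theorem IsLsSolution.sum_mul_nonpos {N : ℕ} {τ : ℝ} {y x w : Fin N → ℝ}
    (h : IsLsSolution τ y x) (hw : l1Norm w ≤ τ) :
    ∑ i, (y i - x i) * (w i - x i) ≤ 0 := by
  set A := ∑ i, (y i - x i) * (w i - x i) with hA
  set B := sqDist w x with hB
  have hB0 : 0 ≤ B := Finset.sum_nonneg fun _ _ => sq_nonneg _
  have key : ∀ t : ℝ, 0 ≤ t → t ≤ 1 → 2 * t * A ≤ t ^ 2 * B := by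
    intro t ht0 ht1
    have hfeas : l1Norm (fun i => (1 - t) * x i + t * w i) ≤ τ := by
      have h1 : l1Norm (fun i => (1 - t) * x i + t * w i) ≤ (1 - t) * l1Norm x + t * l1Norm w := by
        unfold l1Norm
        rw [Finset.mul_sum, Finset.mul_sum, ← Finset.sum_add_distrib]
        refine Finset.sum_le_sum fun i _ => (abs_add_le _ _).trans ?_
        rw [abs_mul, abs_mul, abs_of_nonneg ht0, abs_of_nonneg (sub_nonneg.2 ht1)]
      nlinarith [mul_le_mul_of_nonneg_left h.1 (sub_nonneg.2 ht1),
        mul_le_mul_of_nonneg_left hw ht0]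
    have h1 := h.2 _ hfeas
    have h2 : sqDist y (fun i => (1 - t) * x i + t * w i)
        = sqDist y x - 2 * t * A + t ^ 2 * B := by
      rw [hA, hB]
      unfold sqDist
      rw [Finset.mul_sum, Finset.mul_sum, ← Finset.sum_sub_distrib, ← Finset.sum_add_distrib]
      exact Finset.sum_congr rfl fun i _ => by ring
    linarith
  by_contra! hpos
  have h1 : A ≤ B := by
    have := key 1 zero_le_one le_rfl
    nlinarith
  have hBpos : 0 < B := hpos.trans_le h1
  -- This `t` minimizes the distance to `y` along the line through `x` and `w`; `A ≤ B` keeps it in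
  -- `[0, 1]`.
  have h2 := key (A / B) (by positivity) ((div_le_one hBpos).2 h1)
  have e1 : 2 * (A / B) * A = 2 * (A ^ 2 / B) := by ring
  have e2 : (A / B) ^ 2 * B = A ^ 2 / B := by field_simp
  have h3 : 0 < A ^ 2 / B := by positivity
  linarith

/-- Add the variational inequalities at the two projections, each tested against the other. -/
theorem sqDist_lsEstimator_le {N : ℕ} {τ : ℝ} (hτ : 0 ≤ τ) (y y' : Fin N → ℝ) :
    sqDist (lsEstimator τ y) (lsEstimator τ y') ≤ sqDist y y' := by
  set x := lsEstimator τ y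
  set x' := lsEstimator τ y'
  have hx := lsEstimator_spec hτ y
  have hx' := lsEstimator_spec hτ y'
  have h1 := hx.sum_mul_nonpos hx'.1
  have h2 := hx'.sum_mul_nonpos hx.1
  have h3 : 0 ≤ ∑ i, ((y i - y' i) - (x i - x' i)) ^ 2 := Finset.sum_nonneg fun _ _ => sq_nonneg _
  have h4 : sqDist y y' - sqDist x x' = ∑ i, ((y i - y' i) - (x i - x' i)) ^ 2
      - 2 * (∑ i, (y i - x i) * (x' i - x i) + ∑ i, (y' i - x' i) * (x i - x' i)) := by
    unfold sqDist
    rw [← Finset.sum_add_distrib, Finset.mul_sum, ← Finset.sum_sub_distrib,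
      ← Finset.sum_sub_distrib]
    exact Finset.sum_congr rfl fun i _ => by ring
  linarith

theorem continuous_lsEstimator {N : ℕ} {τ : ℝ} (hτ : 0 ≤ τ) :
    Continuous (lsEstimator τ : (Fin N → ℝ) → Fin N → ℝ) := by
  refine continuous_pi fun i => continuous_iff_continuousAt.2 fun y₀ => ?_
  refine tendsto_iff_dist_tendsto_zero.2 ?_
  have hc : Tendsto (fun y => Real.sqrt (sqDist y₀ y)) (𝓝 y₀) (𝓝 0) := by
    have h := (Real.continuous_sqrt.comp (continuous_sqDist y₀)).tendsto y₀
    simpa [sqDist, Function.comp_def] using h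
  refine squeeze_zero (fun _ => dist_nonneg) (fun y => ?_) hc
  rw [dist_comm, Real.dist_eq]
  refine Real.abs_le_sqrt (le_trans ?_ (sqDist_lsEstimator_le hτ y₀ y))
  exact Finset.single_le_sum
    (f := fun i => (lsEstimator τ y₀ i - lsEstimator τ y i) ^ 2) (fun _ _ => sq_nonneg _)
    (Finset.mem_univ i)

theorem lsEstimator_eq_self {N : ℕ} (x₀ : Fin N → ℝ) : lsEstimator (l1Norm x₀) x₀ = x₀ := by
  have h := (lsEstimator_spec (l1Norm_nonneg x₀) x₀).2 x₀ le_rfl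
  refine (eq_of_sqDist_le_zero (h.trans_eq ?_)).symm
  simp [sqDist]

/-- The signal is its own projection, so nonexpansiveness bounds the error by the noise. This gives
integrability of the error and a bound on the risk uniform in the signal. -/
theorem sqDist_lsEstimator_le_noise {N : ℕ} (x₀ : Fin N → ℝ) (η : ℝ) (z : Fin N → ℝ) :
    sqDist (lsEstimator (l1Norm x₀) (x₀ + η • z)) x₀ ≤ η ^ 2 * ∑ i, z i ^ 2 := by
  have h := sqDist_lsEstimator_le (l1Norm_nonneg x₀) (x₀ + η • z) x₀
  rw [lsEstimator_eq_self] at h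
  refine h.trans_eq ?_
  unfold sqDist
  rw [Finset.mul_sum]
  exact Finset.sum_congr rfl fun i _ => by simp [mul_pow]

instance {N : ℕ} : IsProbabilityMeasure (gaussianNoise N) := by
  unfold gaussianNoise; infer_instance

theorem integrable_eval_sq {N : ℕ} (i : Fin N) :
    Integrable (fun z : Fin N → ℝ => z i ^ 2) (gaussianNoise N) :=
  (measurePreserving_eval_gaussianNoise i).integrable_comp_of_integrable integrable_sq_gaussian

theorem integrable_lsError {N : ℕ} (x₀ : Fin N → ℝ) (η : ℝ) :
    Integrable (fun z => sqDist (lsEstimator (l1Norm x₀) (x₀ + η • z)) x₀) (gaussianNoise N) := by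
  refine ((integrable_finsetSum Finset.univ fun i _ => integrable_eval_sq i).const_mul
    (η ^ 2)).mono' ?_ (ae_of_all _ fun z => ?_)
  · have h1 := continuous_lsEstimator (N := N) (l1Norm_nonneg x₀)
    have h2 : Continuous fun z : Fin N → ℝ => lsEstimator (l1Norm x₀) (x₀ + η • z) :=
      h1.comp (by fun_prop)
    have h3 : Continuous fun w : Fin N → ℝ => sqDist w x₀ := by unfold sqDist; fun_prop
    exact (h3.comp h2).aestronglyMeasurable
  · have h0 : 0 ≤ sqDist (lsEstimator (l1Norm x₀) (x₀ + η • z)) x₀ :=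
      Finset.sum_nonneg fun _ _ => sq_nonneg _
    rw [Real.norm_of_nonneg h0]
    exact sqDist_lsEstimator_le_noise x₀ η z

/-- Without boundedness the real supremum would take its default value, and no single signal would
bound it from below. -/
theorem bddAbove_lsRisk (s N : ℕ) {η : ℝ} (hη : 0 < η) :
    BddAbove (Set.range fun x₀ : sparseSignals s N => lsRisk (l1Norm x₀.1) x₀.1 η) := by
  refine ⟨∫ z, ∑ i, z i ^ 2 ∂(gaussianNoise N), ?_⟩
  rintro _ ⟨x₀, rfl⟩
  have h : ∫ z, sqDist (lsEstimator (l1Norm x₀.1) (x₀.1 + η • z)) x₀.1 ∂(gaussianNoise N)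
      ≤ ∫ z, η ^ 2 * ∑ i, z i ^ 2 ∂(gaussianNoise N) :=
    integral_mono (integrable_lsError _ _)
      ((integrable_finsetSum Finset.univ fun i _ => integrable_eval_sq i).const_mul _)
      fun z => sqDist_lsEstimator_le_noise _ _ _
  rw [integral_const_mul] at h
  simp only [lsRisk]
  rw [inv_mul_le_iff₀ (by positivity)]
  exact h

/-! ### Deterministic lower bound for the projection error -/

/-- A large noise entry off the support of a flat signal, paired with a non-positive noise entry
on the support, contributes to the error of the constrained denoiser. -/
theorem le_sqDist_lsEstimator_of_pairing {N : ℕ} {S I : Finset (Fin N)} {J : Fin N → Fin N}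
    {x₀ v : Fin N → ℝ} {K b : ℝ} (hxS : ∀ i ∈ S, x₀ i = K) (hxS' : ∀ i ∉ S, x₀ i = 0)
    (hb : 0 ≤ b) (hbK : b / 2 ≤ K) (hIS : I ⊆ S) (hJ : Set.InjOn J I)
    (hJS : ∀ i ∈ I, J i ∉ S) (hvI : ∀ i ∈ I, v i ≤ 0) (hvJ : ∀ i ∈ I, b ≤ v (J i))
    (hK : (I.card : ℝ) * (b ^ 2 / 2) ≤ (K / 2) ^ 2) :
    (I.card : ℝ) * (b ^ 2 / 2) ≤ sqDist (lsEstimator (l1Norm x₀) (x₀ + v)) x₀ := by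
  have hK0 : 0 ≤ K := le_trans (by positivity) hbK
  set x := lsEstimator (l1Norm x₀) (x₀ + v) with hx
  have hsol : IsLsSolution (l1Norm x₀) (x₀ + v) x := lsEstimator_spec (l1Norm_nonneg x₀) _
  by_contra! hlt
  have hsmall : ∀ i, |x i - x₀ i| ≤ K / 2 := fun i => by
    refine abs_le_of_sq_le_sq ?_ (by positivity)
    have : (x i - x₀ i) ^ 2 ≤ sqDist x x₀ :=
      Finset.single_le_sum (f := fun i => (x i - x₀ i) ^ 2) (fun _ _ => sq_nonneg _)
        (Finset.mem_univ i)
    linarith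
  -- Within `K / 2` of the signal no support entry changes sign when the error is doubled, so the
  -- `ℓ¹` norm is affine on the segment from `x₀` through `x` to the doubled point. Its endpoint is
  -- thus feasible and can be used in the variational inequality.
  have hdouble : l1Norm (fun i => x₀ i + 2 * (x i - x₀ i)) ≤ l1Norm x₀ := by
    have h1 : l1Norm (fun i => x₀ i + 2 * (x i - x₀ i)) = 2 * l1Norm x - l1Norm x₀ := by
      unfold l1Norm
      rw [Finset.mul_sum, ← Finset.sum_sub_distrib]
      refine Finset.sum_congr rfl fun i _ => ?_
      show |x₀ i + 2 * (x i - x₀ i)| = 2 * |x i| - |x₀ i|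
      by_cases hi : i ∈ S
      · have h2 := abs_le.1 (hsmall i)
        rw [hxS i hi] at h2 ⊢
        rw [abs_of_nonneg (by linarith : 0 ≤ K + 2 * (x i - K)),
          abs_of_nonneg (by linarith : 0 ≤ x i), abs_of_nonneg hK0]
        ring
      · rw [hxS' i hi]
        simp [abs_mul]
    linarith [hsol.1]
  set T := I.image J with hT
  have hTcard : T.card = I.card := Finset.card_image_of_injOn hJ
  have hTS : ∀ j ∈ T, j ∉ S := fun j hj => by
    obtain ⟨i, hi, rfl⟩ := Finset.mem_image.1 hj
    exact hJS i hi
  -- Mass `b / 2` moves from each index of `I` to its partner. The amount `b / 2` maximizes `2 * t *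
  -- b - 2 * t ^ 2`, the guaranteed error per pair when `t` is moved.
  set d : Fin N → ℝ := fun j => b / 2 * ((if j ∈ T then 1 else 0) - (if j ∈ I then 1 else 0))
    with hd
  have hdfeas : l1Norm (fun j => x₀ j + d j) ≤ l1Norm x₀ := by
    have h1 : l1Norm (fun j => x₀ j + d j) = ∑ j, (|x₀ j| + d j) := by
      unfold l1Norm
      refine Finset.sum_congr rfl fun j _ => ?_
      by_cases hjT : j ∈ T
      · have hjI : j ∉ I := fun h => hTS j hjT (hIS h)
        simp only [hd, hxS' j (hTS j hjT), if_pos hjT, if_neg hjI]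
        rw [abs_of_nonneg (by simpa using by positivity)]
        simp
      · by_cases hjI : j ∈ I
        · simp only [hd, hxS j (hIS hjI), if_neg hjT, if_pos hjI]
          rw [abs_of_nonneg (by linarith), abs_of_nonneg hK0]
        · simp [hd, hjT, hjI]
    have h2 : ∑ j, d j = 0 := by
      simp only [hd]
      rw [← Finset.mul_sum, Finset.sum_sub_distrib, Finset.sum_ite_mem, Finset.sum_ite_mem]
      simp [hTcard]
    rw [h1, Finset.sum_add_distrib, h2, add_zero]
    exact le_rfl
  have hd2 : ∑ j, d j ^ 2 = I.card * (b ^ 2 / 2) := by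
    have h1 : ∀ j, d j ^ 2 = b ^ 2 / 4 * ((if j ∈ T then 1 else 0) + (if j ∈ I then 1 else 0)) := by
      intro j
      by_cases hjT : j ∈ T
      · have hjI : j ∉ I := fun h => hTS j hjT (hIS h)
        simp only [hd, if_pos hjT, if_neg hjI]; ring
      · by_cases hjI : j ∈ I
        · simp only [hd, if_neg hjT, if_pos hjI]; ring
        · simp only [hd, if_neg hjT, if_neg hjI]; ring
    simp only [h1]
    rw [← Finset.mul_sum, Finset.sum_add_distrib, Finset.sum_ite_mem, Finset.sum_ite_mem]
    simp [hTcard]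
    ring
  have hvd : I.card * (b ^ 2 / 2) ≤ ∑ j, v j * d j := by
    have h1 : ∑ j, v j * d j = b / 2 * (∑ j ∈ T, v j - ∑ j ∈ I, v j) := by
      have h2 : ∀ j, v j * d j
          = b / 2 * ((if j ∈ T then v j else 0) - (if j ∈ I then v j else 0)) := by
        intro j
        simp only [hd]
        split_ifs <;> ring
      simp only [h2]
      rw [← Finset.mul_sum, Finset.sum_sub_distrib, Finset.sum_ite_mem, Finset.sum_ite_mem]
      simp
    have h3 : ∑ j ∈ T, v j = ∑ i ∈ I, v (J i) := Finset.sum_image hJ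
    have h4 : (I.card : ℝ) * b ≤ ∑ i ∈ I, v (J i) := by
      simpa using Finset.sum_le_sum hvJ
    have h5 : ∑ j ∈ I, v j ≤ 0 := Finset.sum_nonpos hvI
    rw [h1, h3]
    nlinarith
  have hv1 := hsol.sum_mul_nonpos hdouble
  have hv2 := hsol.sum_mul_nonpos hdfeas
  have hsq : 0 ≤ ∑ j, (x j - x₀ j - d j) ^ 2 := Finset.sum_nonneg fun _ _ => sq_nonneg _
  -- With `h = x - x₀`, the two variational inequalities add up to `⟨v - h, d⟩ ≤ 0`. Hence `0 ≤ ‖h -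
  -- d‖² ≤ ‖h‖² + ‖d‖² - 2⟨v, d⟩ ≤ ‖h‖² - ‖d‖²`, which contradicts `hlt`.
  have hid : ∑ j, (x j - x₀ j - d j) ^ 2 = sqDist x x₀ + ∑ j, d j ^ 2 - 2 * ∑ j, v j * d j
      + 2 * ((∑ i, ((x₀ + v) i - x i) * (x₀ i + d i - x i))
        + ∑ i, ((x₀ + v) i - x i) * (x₀ i + 2 * (x i - x₀ i) - x i)) := by
    unfold sqDist
    simp only [Finset.mul_sum, ← Finset.sum_add_distrib, ← Finset.sum_sub_distrib]
    exact Finset.sum_congr rfl fun i _ => by simp only [Pi.add_apply]; ring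
  linarith

/-! ### Gaussian tails and the pairing event -/

theorem half_le_gaussian_Iic : 1 / 2 ≤ (gaussianReal 0 1).real (Set.Iic 0) := by
  have hmap : (gaussianReal 0 1).map (fun x => -x) = gaussianReal 0 1 := by
    rw [gaussianReal_map_neg, neg_zero]
  have h1 : (gaussianReal 0 1).real (Set.Ici 0) = (gaussianReal 0 1).real (Set.Iic 0) := by
    conv_lhs => rw [← hmap]
    rw [map_measureReal_apply measurable_neg measurableSet_Ici]
    congr 1
    ext x
    simp
  have h2 := measureReal_union_le (μ := gaussianReal 0 1) (Set.Iic (0 : ℝ)) (Set.Ici 0)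
  rw [Set.Iic_union_Ici, probReal_univ] at h2
  linarith

/-- Only the mass of `[a, a + 1]` is kept. There the exponent is controlled by `(a + 1) ^ 2 / 2 ≤ a
^ 2 + 1`, and both the normalizing constant and `exp (-1)` are at least `1 / 3`. -/
theorem gaussian_Ici_ge {a : ℝ} (ha : 0 ≤ a) :
    1 / 9 * Real.exp (-a ^ 2) ≤ (gaussianReal 0 1).real (Set.Ici a) := by
  have hpdf : ∀ x ∈ Set.Icc a (a + 1), 1 / 9 * Real.exp (-a ^ 2) ≤ gaussianPDFReal 0 1 x := by
    intro x hx
    have h1 : (1 / 3 : ℝ) ≤ (Real.sqrt (2 * Real.pi * (1 : NNReal)))⁻¹ := by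
      rw [one_div]
      refine inv_anti₀ (Real.sqrt_pos.2 (by simp [Real.pi_pos])) ?_
      rw [Real.sqrt_le_left (by norm_num)]
      have := Real.pi_lt_d2
      push_cast
      linarith
    have h2 : (1 / 3 : ℝ) ≤ Real.exp (-1) := by
      rw [Real.exp_neg, one_div]
      exact inv_anti₀ (Real.exp_pos _) (by linarith [Real.exp_one_lt_d9])
    have h3 : Real.exp (-1) * Real.exp (-a ^ 2)
        ≤ Real.exp (-(x - 0) ^ 2 / (2 * (1 : NNReal))) := by
      rw [← Real.exp_add]
      refine Real.exp_le_exp.2 ?_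
      push_cast
      have hx2 : x ^ 2 ≤ (a + 1) ^ 2 := pow_le_pow_left₀ (ha.trans hx.1) hx.2 2
      nlinarith [sq_nonneg (a - 1)]
    unfold gaussianPDFReal
    calc 1 / 9 * Real.exp (-a ^ 2) = 1 / 3 * (1 / 3 * Real.exp (-a ^ 2)) := by ring
      _ ≤ 1 / 3 * (Real.exp (-1) * Real.exp (-a ^ 2)) := by gcongr
      _ ≤ _ := mul_le_mul h1 h3 (by positivity) (by positivity)
  have h1 : ENNReal.ofReal (1 / 9 * Real.exp (-a ^ 2)) ≤ gaussianReal 0 1 (Set.Ici a) := by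
    calc ENNReal.ofReal (1 / 9 * Real.exp (-a ^ 2))
        = ∫⁻ _ in Set.Icc a (a + 1), ENNReal.ofReal (1 / 9 * Real.exp (-a ^ 2)) := by
          rw [setLIntegral_const, Real.volume_Icc]; simp
      _ ≤ ∫⁻ x in Set.Icc a (a + 1), gaussianPDF 0 1 x :=
          setLIntegral_mono (measurable_gaussianPDF 0 1) fun x hx =>
            ENNReal.ofReal_le_ofReal (hpdf x hx)
      _ = gaussianReal 0 1 (Set.Icc a (a + 1)) :=
          (gaussianReal_apply 0 one_ne_zero _).symm
      _ ≤ gaussianReal 0 1 (Set.Ici a) := measure_mono Set.Icc_subset_Ici_self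
  exact (ENNReal.ofReal_le_iff_le_toReal (measure_ne_top _ _)).1 h1

theorem gaussianNoise_forall_lt {N : ℕ} (B : Finset (Fin N)) (a : ℝ) :
    (gaussianNoise N).real {z | ∀ j ∈ B, z j < a}
      = (1 - (gaussianReal 0 1).real (Set.Ici a)) ^ B.card := by
  have h1 : {z : Fin N → ℝ | ∀ j ∈ B, z j < a}
      = Set.univ.pi fun j => if j ∈ B then Set.Iio a else Set.univ := by
    ext z
    simp only [Set.mem_ofPred_eq, Set.mem_pi, Set.mem_univ, true_implies]
    refine forall_congr' fun j => ?_
    split_ifs with h <;> simp [h]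
  have h2 : (gaussianReal 0 1).real (Set.Iio a) = 1 - (gaussianReal 0 1).real (Set.Ici a) := by
    rw [← Set.compl_Ici, probReal_compl_eq_one_sub measurableSet_Ici]
  rw [h1, gaussianNoise, measureReal_def, Measure.pi_pi, ENNReal.toReal_prod, ← h2]
  have h3 : ∀ j : Fin N, ((gaussianReal 0 1) (if j ∈ B then Set.Iio a else Set.univ)).toReal
      = if j ∈ B then (gaussianReal 0 1).real (Set.Iio a) else 1 := by
    intro j
    split_ifs <;> simp [measureReal_def]
  simp only [h3]
  rw [Finset.prod_ite_mem]
  simp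

theorem gaussianNoise_forall_lt_le {N : ℕ} (B : Finset (Fin N)) {a : ℝ}
    (h : 2 ≤ (gaussianReal 0 1).real (Set.Ici a) * B.card) :
    (gaussianNoise N).real {z | ∀ j ∈ B, z j < a} ≤ 1 / 4 := by
  set p := (gaussianReal 0 1).real (Set.Ici a) with hp
  have hp1 : p ≤ 1 := measureReal_le_one
  rw [gaussianNoise_forall_lt]
  calc (1 - p) ^ B.card ≤ Real.exp (-p) ^ B.card :=
        pow_le_pow_left₀ (sub_nonneg.2 hp1) (Real.one_sub_le_exp_neg p) _
    _ = Real.exp (-(p * B.card)) := by rw [← Real.exp_nat_mul]; ring_nf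
    _ ≤ Real.exp (-2) := Real.exp_le_exp.2 (by linarith)
    _ ≤ 1 / 4 := by
      rw [Real.exp_neg, one_div]
      refine inv_anti₀ (by norm_num) ?_
      have := Real.quadratic_le_exp_of_nonneg (show (0 : ℝ) ≤ 2 by norm_num)
      linarith

/-- The noise vectors with a non-positive entry at `i` and an entry at least `a` in `B`. -/
def pairingEvent {N : ℕ} (B : Finset (Fin N)) (a : ℝ) (i : Fin N) : Set (Fin N → ℝ) :=
  {z | z i ≤ 0 ∧ ∃ j ∈ B, a ≤ z j}

theorem measurableSet_pairingEvent {N : ℕ} (B : Finset (Fin N)) (a : ℝ) (i : Fin N) :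
    MeasurableSet (pairingEvent B a i) := by
  have h : pairingEvent B a i = {z | z i ≤ 0} ∩ ⋃ j ∈ B, {z | a ≤ z j} := by
    ext; simp [pairingEvent]
  rw [h]
  refine (measurableSet_le (measurable_pi_apply i) measurable_const).inter ?_
  exact Finset.measurableSet_biUnion _ fun j _ =>
    measurableSet_le measurable_const (measurable_pi_apply j)

/-- A union bound: the sign condition has probability at least `1 / 2`, and the block fails with
probability at most `1 / 4`. Independence is needed only inside the block. -/
theorem quarter_le_pairingEvent {N : ℕ} (B : Finset (Fin N)) {a : ℝ} (i : Fin N)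
    (h : 2 ≤ (gaussianReal 0 1).real (Set.Ici a) * B.card) :
    1 / 4 ≤ (gaussianNoise N).real (pairingEvent B a i) := by
  have h1 : 1 / 2 ≤ (gaussianNoise N).real {z | z i ≤ 0} := by
    have hm := (measurePreserving_eval_gaussianNoise i).measureReal_preimage
      (measurableSet_Iic (a := (0 : ℝ))).nullMeasurableSet
    exact half_le_gaussian_Iic.trans_eq hm.symm
  have h2 : {z : Fin N → ℝ | z i ≤ 0} ⊆ pairingEvent B a i ∪ {z | ∀ j ∈ B, z j < a} := by
    intro z hz
    by_cases hB : ∃ j ∈ B, a ≤ z j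
    · exact Or.inl ⟨hz, hB⟩
    · push Not at hB
      exact Or.inr hB
  have h3 := (measureReal_mono (μ := gaussianNoise N) h2).trans (measureReal_union_le _ _)
  linarith [gaussianNoise_forall_lt_le B h]

/-! ### Lower bound for the optimally tuned constrained risk -/

/-- Every support index whose pairing event occurs adds `(η * a) ^ 2 / 2` to the error. Disjoint
blocks make the partners distinct, and linearity of expectation handles the dependence between
events. -/
theorem lsOptRisk_ge {s N : ℕ} {a η : ℝ} (hη : 0 < η) (ha : 0 ≤ a) (hs : 1 ≤ s) (hN : s ≤ N)
    (B : Fin N → Finset (Fin N)) (hB : ∀ i i' j, j ∈ B i → j ∈ B i' → (i : ℕ) < s →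
      (i' : ℕ) < s → i = i') (hBs : ∀ i, ∀ j ∈ B i, s ≤ (j : ℕ))
    (hcard : ∀ i : Fin N, (i : ℕ) < s → 2 ≤ (gaussianReal 0 1).real (Set.Ici a) * (B i).card) :
    s * (a ^ 2 / 8) ≤ lsOptRisk s N η := by
  classical
  have hs' : (1 : ℝ) ≤ s := by exact_mod_cast hs
  set S : Finset (Fin N) := Finset.univ.filter fun i => (i : ℕ) < s with hS
  have hScard : S.card = s := card_filter_val_lt hN
  -- The height gives `(K / 2) ^ 2 = s ^ 2 * (η * a) ^ 2`, enough for any number of pairs up to `s`.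
  set K : ℝ := 2 * (η * a) * s with hK
  set x₀ : Fin N → ℝ := fun i => if i ∈ S then K else 0 with hx₀
  have hsparse : x₀ ∈ sparseSignals s N := by
    have h1 : (Finset.univ.filter fun i => x₀ i ≠ 0) ⊆ S := fun i hi => by
      by_contra hiS
      simp [hx₀, hiS] at hi
    exact (Finset.card_le_card h1).trans_eq hScard
  have hpt : ∀ z : Fin N → ℝ,
      η ^ 2 * (a ^ 2 / 2) * ∑ i ∈ S, (pairingEvent (B i) a i).indicator 1 z
        ≤ sqDist (lsEstimator (l1Norm x₀) (x₀ + η • z)) x₀ := by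
    intro z
    set I := S.filter fun i => z ∈ pairingEvent (B i) a i with hI
    have hsum : ∑ i ∈ S, (pairingEvent (B i) a i).indicator (1 : (Fin N → ℝ) → ℝ) z = I.card := by
      simp only [Set.indicator_apply, Pi.one_apply]
      rw [← Finset.sum_filter, Finset.sum_const, nsmul_eq_mul, mul_one]
    have hIs : (I.card : ℝ) ≤ s := by
      exact_mod_cast (Finset.card_filter_le _ _).trans_eq hScard
    have hIE : ∀ i ∈ I, (i : ℕ) < s ∧ z i ≤ 0 ∧ ∃ j ∈ B i, a ≤ z j := fun i hi => by
      obtain ⟨h1, h2⟩ := Finset.mem_filter.1 hi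
      exact ⟨(Finset.mem_filter.1 h1).2, h2⟩
    choose! J hJB hJa using fun i hi => (hIE i hi).2.2
    have hKI : (I.card : ℝ) * ((η * a) ^ 2 / 2) ≤ (K / 2) ^ 2 := by
      have e : (K / 2) ^ 2 = (s * s) * (η * a) ^ 2 := by rw [hK]; ring
      rw [e]
      nlinarith [sq_nonneg (η * a), mul_le_mul_of_nonneg_right hIs (sq_nonneg (η * a)),
        mul_le_mul_of_nonneg_right (mul_le_mul_of_nonneg_left hs' (by linarith : (0 : ℝ) ≤ s))
          (sq_nonneg (η * a))]
    have h := le_sqDist_lsEstimator_of_pairing (S := S) (I := I) (J := J) (x₀ := x₀)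
      (v := η • z) (K := K) (b := η * a) (fun i hi => if_pos hi) (fun i hi => if_neg hi)
      (by positivity) (by rw [hK]; nlinarith [mul_nonneg hη.le ha]) (Finset.filter_subset _ _)
      (fun i hi i' hi' e => hB i i' (J i) (hJB i hi) (e ▸ hJB i' hi') (hIE i hi).1 (hIE i' hi').1)
      (fun i hi hJS => absurd (Finset.mem_filter.1 hJS).2 (not_lt.2 (hBs i _ (hJB i hi))))
      (fun i hi => mul_nonpos_of_nonneg_of_nonpos hη.le (hIE i hi).2.1)
      (fun i hi => mul_le_mul_of_nonneg_left (hJa i hi) hη.le) hKI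
    rw [hsum]
    refine le_trans (le_of_eq ?_) h
    ring
  have hi : ∀ i ∈ S, Integrable ((pairingEvent (B i) a i).indicator (1 : (Fin N → ℝ) → ℝ))
      (gaussianNoise N) := fun i _ =>
    (integrable_const (1 : ℝ)).indicator (measurableSet_pairingEvent (B i) a i)
  have hint := integral_mono ((integrable_finsetSum S hi).const_mul (η ^ 2 * (a ^ 2 / 2)))
    (integrable_lsError x₀ η) hpt
  rw [integral_const_mul, integral_finsetSum _ hi] at hint
  have hP : (s : ℝ) * (1 / 4) ≤ ∑ i ∈ S,
      ∫ z, (pairingEvent (B i) a i).indicator (1 : (Fin N → ℝ) → ℝ) z ∂(gaussianNoise N) := by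
    rw [← hScard, ← nsmul_eq_mul, ← Finset.sum_const]
    refine Finset.sum_le_sum fun i hiS => ?_
    rw [integral_indicator_one (measurableSet_pairingEvent (B i) a i)]
    exact quarter_le_pairingEvent (B i) i (hcard i (Finset.mem_filter.1 hiS).2)
  have hrisk : s * (a ^ 2 / 8) ≤ lsRisk (l1Norm x₀) x₀ η := by
    unfold lsRisk
    rw [le_inv_mul_iff₀ (by positivity)]
    refine le_trans ?_ hint
    calc η ^ 2 * (s * (a ^ 2 / 8)) = η ^ 2 * (a ^ 2 / 2) * (s * (1 / 4)) := by ring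
      _ ≤ _ := mul_le_mul_of_nonneg_left hP (by positivity)
  exact hrisk.trans (le_ciSup (bddAbove_lsRisk s N hη) ⟨x₀, hsparse⟩)

/-- The indices from `s` on that are congruent to `i` modulo `s`. -/
def residueBlock (s : ℕ) {N : ℕ} (i : Fin N) : Finset (Fin N) :=
  Finset.univ.filter fun j => s ≤ (j : ℕ) ∧ (j : ℕ) % s = i

theorem card_residueBlock_ge {s N m : ℕ} (hm : s * (m + 1) ≤ N) {i : Fin N} (hi : (i : ℕ) < s) :
    m ≤ (residueBlock s i).card := by
  have hlt : ∀ k : Fin m, s * ((k : ℕ) + 1) + i < N := fun k => by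
    have h1 : s * ((k : ℕ) + 1 + 1) ≤ s * (m + 1) := Nat.mul_le_mul_left _ (by omega)
    have h2 : s * ((k : ℕ) + 1 + 1) = s * ((k : ℕ) + 1) + s := by ring
    omega
  have h := Finset.card_le_card_of_injOn (s := (Finset.univ : Finset (Fin m)))
    (t := residueBlock s i) (fun k => ⟨s * ((k : ℕ) + 1) + i, hlt k⟩) (fun k _ => by
      simp only [residueBlock, Finset.coe_filter, Finset.mem_univ, true_and, Set.mem_ofPred_eq]
      refine ⟨by nlinarith [Nat.zero_le (s * (k : ℕ))], ?_⟩
      rw [Nat.mul_add_mod, Nat.mod_eq_of_lt hi]) (fun k _ k' _ e => by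
      have e1 : s * ((k : ℕ) + 1) + i = s * ((k' : ℕ) + 1) + i := congrArg Fin.val e
      have e2 := Nat.eq_of_mul_eq_mul_left (by omega : 0 < s) (Nat.add_right_cancel e1)
      exact Fin.ext (by omega))
  simpa using h

theorem lsOptRisk_ge_log {s N : ℕ} {η : ℝ} (hη : 0 < η) (hs : 1 ≤ s) (hN : 1296 * s ^ 2 ≤ N) :
    s * Real.log N / 32 ≤ lsOptRisk s N η := by
  have hs' : (1 : ℝ) ≤ s := by exact_mod_cast hs
  have hNr : 1296 * (s : ℝ) ^ 2 ≤ N := by exact_mod_cast hN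
  have hNpos : (0 : ℝ) < N := by nlinarith
  have hlog : 0 ≤ Real.log N := Real.log_nonneg (by nlinarith)
  have hsN : s ≤ N := by nlinarith
  set q := Real.sqrt N with hq
  have hq2 : q ^ 2 = N := Real.sq_sqrt hNpos.le
  have hqs : 36 * (s : ℝ) ≤ q := Real.le_sqrt_of_sq_le (by nlinarith)
  have hqpos : 0 < q := by linarith
  have hsq : (Real.sqrt (Real.log N) / 2) ^ 2 = Real.log N / 4 := by
    rw [div_pow, Real.sq_sqrt hlog]; norm_num
  have hp : 1 / (9 * q) ≤ (gaussianReal 0 1).real (Set.Ici (Real.sqrt (Real.log N) / 2)) := by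
    refine le_trans ?_ (gaussian_Ici_ge (by positivity))
    -- The tail factor is `N ^ (-1/4)`; the cruder `N ^ (-1/2)` suffices, since the blocks have size
    -- at least `18 * √N`.
    have h1 : q⁻¹ ≤ Real.exp (-(Real.log N / 4)) := by
      rw [← Real.exp_log (inv_pos.2 hqpos), Real.log_inv, hq, Real.log_sqrt hNpos.le]
      exact Real.exp_le_exp.2 (by linarith)
    rw [hsq, one_div, mul_inv, ← one_div]
    gcongr
  have hm : s * ((N / s - 1) + 1) ≤ N := by
    rw [Nat.sub_add_cancel ((Nat.one_le_div_iff (by omega)).2 hsN)]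
    exact Nat.mul_div_le N s
  -- Since `q ≥ 36 * s`, the quotient `q ^ 2 / s` is at least `36 * q`; rounding and the loss of the
  -- first `s` indices cost at most `2`.
  have hmr : 18 * q ≤ ((N / s - 1 : ℕ) : ℝ) := by
    have h1 : N < s * (N / s + 1) := Nat.lt_mul_div_succ N (by omega)
    have h2 : N < s * ((N / s - 1) + 2) := by
      refine h1.trans_le (Nat.mul_le_mul_left _ (by omega))
    have h3 : (N : ℝ) < s * (((N / s - 1 : ℕ) : ℝ) + 2) := by exact_mod_cast h2
    by_contra! hlt
    nlinarith
  have h := lsOptRisk_ge hη (a := Real.sqrt (Real.log N) / 2) (by positivity) hs hsN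
    (residueBlock s) (fun i i' j hj hj' _ _ => Fin.ext
      ((Finset.mem_filter.1 hj).2.2.symm.trans (Finset.mem_filter.1 hj').2.2))
    (fun i j hj => (Finset.mem_filter.1 hj).2.1) (fun i hi => by
      have h1 : 18 * q ≤ ((residueBlock s i).card : ℝ) :=
        hmr.trans (by exact_mod_cast card_residueBlock_ge hm hi)
      calc (2 : ℝ) = 1 / (9 * q) * (18 * q) := by field_simp; norm_num
        _ ≤ _ := mul_le_mul hp h1 (by positivity) measureReal_nonneg)
  rw [hsq] at h
  linarith

/-! ### Right-sided stability -/

theorem mainTheorem7 :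
    ∃ C : ℝ, 0 < C ∧ ∀ s : ℕ, 1 ≤ s → ∀ L : ℝ, 1 < L →
      ∃ N₀ : ℕ, 2 ≤ N₀ ∧ ∀ N : ℕ, N₀ ≤ N →
        -- the low-noise risk is a genuine limit, common to all signals with `s` non-zero entries
        (∀ lam : ℝ, 0 < lam → ∀ x₀ : Fin N → ℝ, hammingNorm x₀ = s →
          Tendsto (qpRisk lam x₀) (𝓝[>] (0 : ℝ)) (𝓝 (lowNoiseRisk lam s N))) ∧
        -- the risk-optimal parameter is well defined
        (∃! lamStar : ℝ, IsOptimalParam s N lamStar) ∧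
        -- right-sided stability
        ∀ lamStar : ℝ, IsOptimalParam s N lamStar → ∀ η : ℝ, 0 < η →
          0 < lsOptRisk s N η ∧
            lowNoiseRisk (L * lamStar) s N / lsOptRisk s N η ≤ C * L ^ 2 := by
  -- Here `224 = 7 * 32` combines the upper constant `7` with the lower constant `1 / 32`, and `1296
  -- = 36 ^ 2` gives `√N ≥ 36 * s`.
  refine ⟨224, by norm_num, fun s hs L hL => ⟨1296 * s ^ 2, by nlinarith, fun N hN => ?_⟩⟩
  have hs' : (1 : ℝ) ≤ s := by exact_mod_cast hs
  have hNr : 1296 * (s : ℝ) ^ 2 ≤ N := by exact_mod_cast hN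
  have hsN : s ≤ N := by nlinarith
  have hNpos : (0 : ℝ) < N := by nlinarith
  have hlog : 0 < Real.log N := Real.log_pos (by nlinarith)
  have hF := limitRisk_sqrt_log_le hs hsN (by nlinarith)
  refine ⟨fun lam hlam x₀ hx => ?_, ?_, fun lamStar hopt η hη => ?_⟩
  · rw [lowNoiseRisk_eq hsN hlam.le]
    exact tendsto_qpRisk hlam.le hx
  · refine existsUnique_isOptimalParam hs hsN (Real.sqrt_nonneg _) (hF.trans_lt ?_)
    have hq2 : Real.sqrt N ^ 2 = N := Real.sq_sqrt hNpos.le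
    have hqs : 36 * (s : ℝ) ≤ Real.sqrt N := Real.le_sqrt_of_sq_le (by nlinarith)
    -- This yields `7 * s * log N ≤ 14 * s * √N ≤ (14 / 36) * N < N`, so the risk at `√(2 log N)`
    -- beats the value at `0`.
    have h1 : Real.log N ≤ 2 * Real.sqrt N := by
      have h2 := Real.log_le_self (Real.sqrt_nonneg N)
      rw [Real.log_sqrt hNpos.le] at h2
      linarith
    nlinarith
  · have hlow := lsOptRisk_ge_log hη hs hN
    have hpos : 0 < s * Real.log N / 32 := by positivity
    refine ⟨hpos.trans_le hlow, ?_⟩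
    rw [div_le_iff₀ (hpos.trans_le hlow)]
    have h1 : lowNoiseRisk lamStar s N ≤ 7 * s * Real.log N := by
      refine (hopt.2 (Real.sqrt (2 * Real.log N)) (Real.sqrt_pos.2 (by linarith))).trans ?_
      rw [lowNoiseRisk_eq hsN (Real.sqrt_nonneg _)]
      exact hF
    have h2 : lowNoiseRisk (L * lamStar) s N ≤ L ^ 2 * lowNoiseRisk lamStar s N := by
      have h0 := hopt.1.le
      rw [lowNoiseRisk_eq hsN h0, lowNoiseRisk_eq hsN (by positivity)]
      exact limitRisk_mul_le hsN hL.le h0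
    calc lowNoiseRisk (L * lamStar) s N ≤ L ^ 2 * lowNoiseRisk lamStar s N := h2
      _ ≤ L ^ 2 * (7 * s * Real.log N) := by gcongr
      _ = 224 * L ^ 2 * (s * Real.log N / 32) := by ring
      _ ≤ 224 * L ^ 2 * lsOptRisk s N η := by gcongr
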